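/- Let $T_n$ be the Chebyshev polynomials of the first kind, $T_0(x)=1$, $T_1(x)=x$, $T_n(x)=2xT_{n-1}(x)-T_{n-2}(x)$. Let $k\ge 1$ and $n\ge 1$ be integers such that $T_n$ is a permutation polynomial modulo $2^k$, i.e. $x\mapsto T_n(x)\bmod 2^k$ is a bijection of $\mathbb{Z}_{2^k}=\{0,1,\dots,2^k-1\}$. For $x\in\mathbb{Z}_{2^k}$ let $L(n,2,k,x)$ be the least integer $N\ge 1$ such that the $N$-fold iterate of $T_n$ satisfies $T_n^{N}(x)\equiv x\pmod{2^k}$. Let $\nu_2$ denote the $2$-adic valuation on $\mathbb{Z}$, with $\nu_2(0)=\infty$, and put $$\nu_2^*(m)=\max\{\nu_2(m-1),\,\nu_2(m+1)\},\qquad k'=k-\nu_2^*(n)$$ (so $k'=-\infty$ if $n=1$). Then $$ L(n,2,k,x)=\begin{cases} 2^{\,k'-\nu_2(x)} & \text{if } x\equiv 0 \pmod 2,\ k'>1 \text{ and } \nu_2(x)\le k',\\ 2^{\,k'-\nu_2^*(x)-1} & \text{if } x\equiv 1 \pmod 2,\ k'>3 \text{ and } \nu_2^*(x)+1\le k',\\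 1 & \text{otherwise.} \end{cases} $$ -/

import Mathlib

open Polynomial

/-- The map `x ↦ T_n(x)` on `ℤ / 2 ^ k`, where `T_n` is the `n`-th Chebyshev polynomial of the
first kind. -/
noncomputable def chebMap (n k : ℕ) (x : ZMod (2 ^ k)) : ZMod (2 ^ k) :=
  (Polynomial.Chebyshev.T (ZMod (2 ^ k)) (n : ℤ)).eval x

/-- `T_n` is a permutation polynomial modulo `2 ^ k`. -/
def IsChebPermutation (n k : ℕ) : Prop :=
  Function.Bijective (chebMap n k)

/-- The period `L(n, 2, k, x)`: the least `N ≥ 1` such that the `N`-th iterate of `T_n` fixes `x`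
modulo `2 ^ k` (and `0` if there were no such `N`). -/
noncomputable def chebPeriod (n k : ℕ) (x : ZMod (2 ^ k)) : ℕ :=
  Function.minimalPeriod (chebMap n k) x

/-- The `2`-adic valuation of an integer, with value `∞` at `0`. -/
noncomputable def nuTwo (m : ℤ) : ℕ∞ := emultiplicity 2 m

/-- `max {ν₂(m - 1), ν₂(m + 1)}`; it is `∞` exactly for `m = 1` and `m = -1`. -/
noncomputable def nuTwoStar (m : ℤ) : ℕ∞ := max (nuTwo (m - 1)) (nuTwo (m + 1))

/-- `k' = k - ν₂*(n)`, cut off at `0`. The cut-off is harmless: `k'` is only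
used when it is greater than `1`. -/
noncomputable def kPrime (n k : ℕ) : ℕ∞ := (k : ℕ∞) - nuTwoStar (n : ℤ)

open Classical in
/-- The explicit period. In the first two cases the exponent is the true, finite and nonnegative
difference, by the conditions of the case. -/
noncomputable def periodFormula (n k : ℕ) (x : ZMod (2 ^ k)) : ℕ :=
  if Even x.val ∧ 1 < kPrime n k ∧ nuTwo (x.val : ℤ) ≤ kPrime n k then
    2 ^ (kPrime n k - nuTwo (x.val : ℤ)).toNat
  else if Odd x.val ∧ 3 < kPrime n k ∧ nuTwoStar (x.val : ℤ) + 1 ≤ kPrime n k then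
    2 ^ (kPrime n k - nuTwoStar (x.val : ℤ) - 1).toNat
  else 1

/-!
Since `T_a ∘ T_b = T_{ab}`, the `N`-th iterate of `T_n` is `T_m` with `m = n ^ N`, so the period of
`x` modulo `2 ^ k` is the least `N ≥ 1` with `k ≤ ν₂(T_m(x) - x)`. A permutation polynomial `T_n`
modulo `2 ^ k` has odd index (`IsChebPermutation.odd`), so only odd `m` matter.

For odd `m = 2b + 1` the identity `T_m - T_1 = 2 (X² - 1) U_b U_{b-1}` (`T_add_sub_T_sub`) reduces
the valuation of `T_m(x) - x` to those of values of `U`, which follow from the duplication formula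
`U_{2d-1} = 2 T_d U_{d-1}` and the parities of `T_{2j}(x)`, `T_{2j+1}(x) / x` and `U_{2j}(x)`
(`emultiplicity_eval_U_sub_one`). The outcome is the formula
`ν₂(T_m(x) - x) = ν₂*(m) + ν₂(x³ - x)`, valid for all integers `x`
(`emultiplicity_eval_T_sub_self`).

Lifting the exponent gives `ν₂*(n ^ N) = ν₂*(n) + ν₂(N)` (`nuTwoStar_pow`). Hence `N` is a period of
`x` exactly if `ν₂(N) ≥ k' - ν₂(x³ - x)`, and the least period is `2` to that power, the difference
being cut off at `0` (`chebPeriod_eq`). Finally `ν₂(x³ - x)` equals `ν₂(x) ≥ 1` for even `x` and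
`ν₂*(x) + 1 ≥ 3` for odd `x`.
-/

/-! ### Product formulas for Chebyshev polynomials -/

/-- The analogue for Chebyshev polynomials of
`2 cos β sin α = sin (α + β) + sin (α - β)`. -/
theorem two_mul_T_mul_U {R : Type*} [CommRing R] (m n : ℤ) :
    2 * Chebyshev.T R n * Chebyshev.U R m = Chebyshev.U R (m + n) + Chebyshev.U R (m - n) := by
  induction n using Chebyshev.induct with
  | zero => simp [two_mul]
  | one => rw [Chebyshev.U_add_one, Chebyshev.T_one]; ring
  | add_two n ih1 ih2 =>
    have h₁ := Chebyshev.U_add_two R (m + n)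
    have h₂ := Chebyshev.U_sub_two R (m - n)
    have h₃ := Chebyshev.T_add_two R n
    linear_combination (norm := ring_nf) 2 * Chebyshev.U R m * h₃ - h₂ - h₁ - ih2 + 2 * X * ih1
  | neg_add_one n ih1 ih2 =>
    have h₁ := Chebyshev.U_add_two R (m + (-n - 1))
    have h₂ := Chebyshev.U_sub_two R (m - (-n - 1))
    have h₃ := Chebyshev.T_add_two R (-n - 1)
    linear_combination (norm := ring_nf) 2 * Chebyshev.U R m * h₃ - h₂ - h₁ - ih2 + 2 * X * ih1

/-- The analogue for Chebyshev polynomials of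
`cos (α + β) - cos (α - β) = -2 sin α sin β`. -/
theorem T_add_sub_T_sub {R : Type*} [CommRing R] (m n : ℤ) :
    Chebyshev.T R (m + n) - Chebyshev.T R (m - n) =
      2 * (X ^ 2 - 1) * Chebyshev.U R (m - 1) * Chebyshev.U R (n - 1) := by
  induction n using Chebyshev.induct with
  | zero => simp
  | one =>
    have h₁ := Chebyshev.one_sub_X_sq_mul_U_eq_pol_in_T R (m - 1)
    have h₂ := Chebyshev.T_add_one R m
    have h₃ := Chebyshev.U_zero R
    simp only [sub_self, h₃]
    linear_combination (norm := ring_nf) 2 * h₁ - h₂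
  | add_two n ih1 ih2 =>
    have h₁ := Chebyshev.T_add_two R (m + n)
    have h₂ := Chebyshev.T_sub_two R (m - n)
    have h₃ := Chebyshev.U_add_two R (n - 1)
    linear_combination (norm := ring_nf)
      -2 * (X ^ 2 - 1) * Chebyshev.U R (m - 1) * h₃ - h₂ + h₁ - ih2 + 2 * X * ih1
  | neg_add_one n ih1 ih2 =>
    have h₁ := Chebyshev.T_sub_two R (m - n + 1)
    have h₂ := Chebyshev.T_add_two R (m + n - 1)
    have h₃ := Chebyshev.U_sub_two R (-n)
    linear_combination (norm := ring_nf)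
      -2 * (X ^ 2 - 1) * Chebyshev.U R (m - 1) * h₃ - h₂ + h₁ - ih2 + 2 * X * ih1

/-! ### 2-adic valuations of Chebyshev values -/

theorem odd_eval_T_two_mul (x : ℤ) (j : ℕ) : Odd ((Chebyshev.T ℤ (2 * j)).eval x) := by
  induction j with
  | zero => simp
  | succ j ih =>
    have h := Chebyshev.T_add_two ℤ (2 * j)
    rw [show (2 * ((j + 1 : ℕ) : ℤ)) = 2 * j + 2 by push_cast; ring, h]
    simp only [eval_sub, eval_mul, eval_ofNat, eval_X, mul_assoc]
    exact (even_two_mul _).sub_odd ih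

theorem exists_odd_eval_T_two_mul_add_one (x : ℤ) (j : ℕ) :
    ∃ q : ℤ, Odd q ∧ (Chebyshev.T ℤ (2 * j + 1)).eval x = x * q := by
  induction j with
  | zero => exact ⟨1, by simp⟩
  | succ j ih =>
    obtain ⟨q, hq, h⟩ := ih
    refine ⟨2 * (Chebyshev.T ℤ (2 * j + 2)).eval x - q, (even_two_mul _).sub_odd hq, ?_⟩
    rw [show (2 * ((j + 1 : ℕ) : ℤ) + 1) = 2 * j + 1 + 2 by push_cast; ring,
      Chebyshev.T_add_two ℤ (2 * j + 1), add_assoc, one_add_one_eq_two]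
    simp only [eval_sub, eval_mul, eval_ofNat, eval_X, h]
    ring

theorem odd_eval_U_two_mul (x : ℤ) (j : ℕ) : Odd ((Chebyshev.U ℤ (2 * j)).eval x) := by
  induction j with
  | zero => simp
  | succ j ih =>
    have h := Chebyshev.U_add_two ℤ (2 * j)
    rw [show (2 * ((j + 1 : ℕ) : ℤ)) = 2 * j + 2 by push_cast; ring, h]
    simp only [eval_sub, eval_mul, eval_ofNat, eval_X, mul_assoc]
    exact (even_two_mul _).sub_odd ih

theorem emultiplicity_two_of_odd {a : ℤ} (ha : Odd a) : emultiplicity 2 a = 0 :=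
  emultiplicity_eq_zero.2 (by rwa [← even_iff_two_dvd, Int.not_even_iff_odd])

theorem emultiplicity_two_two_mul (a : ℤ) :
    emultiplicity 2 (2 * a) = 1 + emultiplicity 2 a := by
  rw [emultiplicity_mul Int.prime_two]
  congr 1
  simpa using emultiplicity_pow_self_of_prime Int.prime_two 1

/-- Each halving `U_{2d-1} = 2 T_d U_{d-1}` of an even index contributes a factor `2`, and the
final odd `d` contributes `T_d(x)`, an odd multiple of `x`. For `c = 0` both sides are `∞`, since
`U_{-1} = 0`. -/
theorem emultiplicity_eval_U_sub_one (x : ℤ) {c : ℕ} (hc : Even c) :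
    emultiplicity 2 ((Chebyshev.U ℤ (c - 1)).eval x) =
      emultiplicity 2 (c : ℤ) + emultiplicity 2 x := by
  induction c using Nat.strong_induction_on with
  | _ c ih =>
    obtain rfl | hpos := c.eq_zero_or_pos
    · simp
    obtain ⟨d, rfl⟩ := hc.exists_two_nsmul
    simp only [smul_eq_mul] at *
    have h : Chebyshev.U ℤ (((2 * d : ℕ) : ℤ) - 1) =
        2 * (Chebyshev.T ℤ d * Chebyshev.U ℤ (d - 1)) := by
      have := two_mul_T_mul_U (R := ℤ) ((d : ℤ) - 1) d
      rw [show (d : ℤ) - 1 - d = -1 by ring, Chebyshev.U_neg_one, add_zero] at this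
      rw [← mul_assoc, this]
      congr 1
      push_cast
      ring
    rw [h, eval_mul, eval_mul, eval_ofNat, emultiplicity_two_two_mul,
      emultiplicity_mul Int.prime_two, Nat.cast_mul, Nat.cast_ofNat, emultiplicity_two_two_mul]
    rcases d.even_or_odd' with ⟨j, rfl | rfl⟩
    · rw [ih (2 * j) (by omega) (even_two_mul j)]
      push_cast
      rw [emultiplicity_two_of_odd (odd_eval_T_two_mul x j), zero_add, add_assoc]
    · push_cast
      obtain ⟨q, hq, hT⟩ := exists_odd_eval_T_two_mul_add_one x j
      rw [hT, emultiplicity_mul Int.prime_two, emultiplicity_two_of_odd hq, add_sub_cancel_right,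
        emultiplicity_two_of_odd (odd_eval_U_two_mul x j),
        emultiplicity_two_of_odd (odd_two_mul_add_one (j : ℤ))]
      simp

/-- One of `b`, `b + 1` is odd, so the maximum in `nuTwoStar` may be replaced by a sum. -/
theorem nuTwoStar_two_mul_add_one (b : ℤ) :
    nuTwoStar (2 * b + 1) = 1 + emultiplicity 2 b + emultiplicity 2 (b + 1) := by
  rw [nuTwoStar, nuTwo, nuTwo, add_sub_cancel_right, show 2 * b + 1 + 1 = 2 * (b + 1) by ring,
    emultiplicity_two_two_mul, emultiplicity_two_two_mul]
  rcases b.even_or_odd with hb | hb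
  · simp [emultiplicity_two_of_odd hb.add_one]
  · simp [emultiplicity_two_of_odd hb]

theorem emultiplicity_sq_sub_one {m : ℤ} (hm : Odd m) :
    emultiplicity 2 (m ^ 2 - 1) = nuTwoStar m + 1 := by
  obtain ⟨b, rfl⟩ := hm
  rw [nuTwoStar_two_mul_add_one, show (2 * b + 1) ^ 2 - 1 = 2 * (2 * (b * (b + 1))) by ring,
    emultiplicity_two_two_mul, emultiplicity_two_two_mul, emultiplicity_mul Int.prime_two]
  ring

/-- The central formula: for odd `m`, the distance of `T_m(x)` from `x` is governed separately by
`m` and by `x`. Both sides are `∞` for `m = 1` and for `x ∈ {-1, 0, 1}`. -/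
theorem emultiplicity_eval_T_sub_self (x : ℤ) {m : ℕ} (hm : Odd m) :
    emultiplicity 2 ((Chebyshev.T ℤ m).eval x - x) =
      nuTwoStar m + emultiplicity 2 (x ^ 3 - x) := by
  obtain ⟨b, rfl⟩ := hm
  have h : (Chebyshev.T ℤ ((2 * b + 1 : ℕ) : ℤ)).eval x - x =
      2 * ((x ^ 2 - 1) * ((Chebyshev.U ℤ b).eval x * (Chebyshev.U ℤ (b - 1)).eval x)) := by
    have := congrArg (eval x) (T_add_sub_T_sub (R := ℤ) (b + 1) b)
    simp only [add_sub_cancel_left, add_sub_cancel_right, Chebyshev.T_one, eval_sub, eval_mul,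
      eval_ofNat, eval_X, eval_pow, eval_one] at this
    rw [show ((2 * b + 1 : ℕ) : ℤ) = b + 1 + b by push_cast; ring, this]
    ring
  -- One of `U_b`, `U_{b-1}` has even index, hence an odd value; the other falls under
  -- `emultiplicity_eval_U_sub_one`.
  have hU : emultiplicity 2 ((Chebyshev.U ℤ b).eval x) +
      emultiplicity 2 ((Chebyshev.U ℤ (b - 1)).eval x) =
      emultiplicity 2 (b : ℤ) + emultiplicity 2 ((b : ℤ) + 1) + emultiplicity 2 x := by
    rcases b.even_or_odd' with ⟨j, rfl | rfl⟩
    · rw [emultiplicity_eval_U_sub_one x (even_two_mul j)]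
      push_cast
      rw [emultiplicity_two_of_odd (odd_eval_U_two_mul x j),
        emultiplicity_two_of_odd (odd_two_mul_add_one (j : ℤ)), zero_add, add_zero]
    · have := emultiplicity_eval_U_sub_one x (c := 2 * j + 1 + 1) ⟨j + 1, by ring⟩
      push_cast at this ⊢
      rw [add_sub_cancel_right] at this
      rw [this, add_sub_cancel_right, emultiplicity_two_of_odd (odd_eval_U_two_mul x j),
        emultiplicity_two_of_odd (odd_two_mul_add_one (j : ℤ)), zero_add, add_zero]
  rw [h, emultiplicity_two_two_mul, emultiplicity_mul Int.prime_two,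
    emultiplicity_mul Int.prime_two, hU]
  push_cast
  rw [nuTwoStar_two_mul_add_one, show x ^ 3 - x = (x ^ 2 - 1) * x by ring,
    emultiplicity_mul Int.prime_two]
  ring

/-! ### The exponent and the point -/

/-- Lifting the exponent, applied to `n ^ 2` so that the exponent `N` may have either parity. -/
theorem nuTwoStar_pow {n : ℤ} (hn : Odd n) (N : ℕ) :
    nuTwoStar (n ^ N) = nuTwoStar n + emultiplicity 2 N := by
  have h4 : (4 : ℤ) ∣ n ^ 2 - 1 := by
    obtain ⟨b, rfl⟩ := hn
    exact ⟨b * (b + 1), by ring⟩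
  have h := Int.two_pow_sub_pow' N h4 (by
    rw [← even_iff_two_dvd, Int.not_even_iff_odd]; exact hn.pow)
  rw [one_pow, ← pow_mul, mul_comm 2 N, pow_mul, emultiplicity_sq_sub_one hn.pow,
    emultiplicity_sq_sub_one hn, add_right_comm] at h
  have h2 : emultiplicity (2 : ℤ) N = emultiplicity 2 N := by
    exact_mod_cast Int.natCast_emultiplicity 2 N
  rw [h2] at h
  exact (ENat.addLECancellable_of_ne_top ENat.one_ne_top).inj_left.1 h

theorem emultiplicity_cube_sub_self_of_even {x : ℤ} (hx : Even x) :
    emultiplicity 2 (x ^ 3 - x) = nuTwo x := by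
  rw [show x ^ 3 - x = (x ^ 2 - 1) * x by ring, emultiplicity_mul Int.prime_two,
    emultiplicity_two_of_odd ((hx.pow_of_ne_zero two_ne_zero).sub_odd odd_one), zero_add, nuTwo]

theorem emultiplicity_cube_sub_self_of_odd {x : ℤ} (hx : Odd x) :
    emultiplicity 2 (x ^ 3 - x) = nuTwoStar x + 1 := by
  rw [show x ^ 3 - x = (x ^ 2 - 1) * x by ring, emultiplicity_mul Int.prime_two,
    emultiplicity_two_of_odd hx, add_zero, emultiplicity_sq_sub_one hx]

/-! ### The period modulo powers of two -/

theorem chebMap_intCast (n k : ℕ) (y : ℤ) :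
    chebMap n k y = ((Chebyshev.T ℤ n).eval y : ℤ) := by
  simpa [chebMap] using (Chebyshev.algebraMap_eval_T (R := ℤ) (R' := ZMod (2 ^ k)) y n).symm

theorem chebMap_iterate (n k N : ℕ) : (chebMap n k)^[N] = chebMap (n ^ N) k := by
  induction N with
  | zero => funext y; simp [chebMap]
  | succ N ih =>
    funext y
    rw [Function.iterate_succ_apply', ih]
    simp only [chebMap]
    rw [pow_succ', Nat.cast_mul, Chebyshev.T_mul, eval_comp]

/-- For even `n` the values of `T_n` at integers are odd, so `0` is not attained modulo `2 ^ k`. -/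
theorem IsChebPermutation.odd {n k : ℕ} (hk : 1 ≤ k) (h : IsChebPermutation n k) : Odd n := by
  by_contra hn
  obtain ⟨j, rfl⟩ := (Nat.not_odd_iff_even.1 hn).exists_two_nsmul
  obtain ⟨y, hy⟩ := h.2 0
  obtain ⟨z, rfl⟩ := ZMod.intCast_surjective y
  rw [chebMap_intCast, ZMod.intCast_zmod_eq_zero_iff_dvd] at hy
  have h2 : (2 : ℤ) ∣ (Chebyshev.T ℤ (2 * j)).eval z := by
    refine (dvd_pow_self 2 (by omega : k ≠ 0)).trans ?_
    simpa using hy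
  exact Int.not_even_iff_odd.2 (odd_eval_T_two_mul z j) (even_iff_two_dvd.2 h2)

/-- The period in uniform form, without case distinction on `x`. The subtraction is truncated, so
the exponent is `0` as soon as `T_n(x) ≡ x`. -/
theorem chebPeriod_eq {n k : ℕ} (hn : Odd n) (x : ZMod (2 ^ k)) :
    chebPeriod n k x =
      2 ^ (kPrime n k - emultiplicity 2 ((x.val : ℤ) ^ 3 - x.val)).toNat := by
  set w := emultiplicity 2 ((x.val : ℤ) ^ 3 - x.val) with hw
  have hfin : kPrime n k - w ≠ ⊤ :=
    ne_top_of_le_ne_top (ENat.natCast_ne_top k) (tsub_le_self.trans tsub_le_self)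
  have key (N : ℕ) : Function.IsPeriodicPt (chebMap n k) N x ↔ 2 ^ (kPrime n k - w).toNat ∣ N := by
    have hx : x = ((x.val : ℤ) : ZMod (2 ^ k)) := by simp
    rw [Function.IsPeriodicPt, Function.IsFixedPt, chebMap_iterate]
    nth_rw 1 2 [hx]
    rw [chebMap_intCast, eq_comm, ZMod.intCast_eq_intCast_iff_dvd_sub, Nat.cast_pow, Nat.cast_ofNat,
      pow_dvd_iff_le_emultiplicity, emultiplicity_eval_T_sub_self _ hn.pow, Nat.cast_pow,
      nuTwoStar_pow (by exact_mod_cast hn), ← hw, pow_dvd_iff_le_emultiplicity,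
      ENat.natCast_toNat hfin, kPrime, tsub_le_iff_right, tsub_le_iff_left, add_assoc]
  rw [chebPeriod]
  refine Nat.dvd_antisymm ?_ ?_
  · exact Function.isPeriodicPt_iff_minimalPeriod_dvd.1 ((key _).2 dvd_rfl)
  · exact (key _).1 (Function.isPeriodicPt_minimalPeriod _ _)

/-- For odd `x` the exponent `k' - ν₂*(x) - 1` can be positive only if `k' > 3`, which is why that
condition in the period formula is consistent with the uniform one. -/
theorem three_le_nuTwoStar_add_one {x : ℤ} (hx : Odd x) : 3 ≤ nuTwoStar x + 1 := by
  obtain ⟨b, rfl⟩ := hx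
  rw [nuTwoStar_two_mul_add_one]
  have h : (1 : ℕ∞) ≤ emultiplicity 2 (b * (b + 1)) := by
    rw [← Nat.cast_one, ← pow_dvd_iff_le_emultiplicity, pow_one]
    exact even_iff_two_dvd.1 (Int.even_mul_succ_self b)
  rw [emultiplicity_mul Int.prime_two] at h
  calc (3 : ℕ∞) = 1 + 1 + 1 := by norm_num
    _ ≤ 1 + (emultiplicity 2 b + emultiplicity 2 (b + 1)) + 1 := by gcongr
    _ = 1 + emultiplicity 2 b + emultiplicity 2 (b + 1) + 1 := by rw [add_assoc 1 (emultiplicity 2 b)]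

theorem mainTheorem5 (n k : ℕ) (hk : 1 ≤ k) (hperm : IsChebPermutation n k)
    (x : ZMod (2 ^ k)) :
    chebPeriod n k x = periodFormula n k x := by
  rw [chebPeriod_eq (hperm.odd hk), periodFormula]
  rcases x.val.even_or_odd with hx | hx
  · have hx' : Even (x.val : ℤ) := by exact_mod_cast hx
    rw [emultiplicity_cube_sub_self_of_even hx', if_neg (c := Odd x.val ∧ _)
      (fun h => Nat.not_odd_iff_even.2 hx h.1)]
    split_ifs with h
    · rfl
    · have h1 : 1 ≤ nuTwo (x.val : ℤ) := by
        rw [nuTwo, ← Nat.cast_one, ← pow_dvd_iff_le_emultiplicity, pow_one]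
        exact even_iff_two_dvd.1 hx'
      have hle : kPrime n k ≤ nuTwo (x.val : ℤ) := by
        by_contra! hlt
        exact h ⟨hx, h1.trans_lt hlt, hlt.le⟩
      rw [tsub_eq_zero_of_le hle]
      rfl
  · have hx' : Odd (x.val : ℤ) := by exact_mod_cast hx
    rw [emultiplicity_cube_sub_self_of_odd hx', if_neg (c := Even x.val ∧ _)
      (fun h => Nat.not_odd_iff_even.2 h.1 hx)]
    split_ifs with h
    · rw [tsub_tsub]
    · have hle : kPrime n k ≤ nuTwoStar (x.val : ℤ) + 1 := by
        by_contra! hlt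
        exact h ⟨hx, (three_le_nuTwoStar_add_one hx').trans_lt hlt, hlt.le⟩
      rw [tsub_eq_zero_of_le hle]
      rfl
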